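/- Let $K$ be an abstract simplicial complex (possibly infinite), and let $|K|$ be its geometric realization: the set of finitely supported functions $x\colon V\to[0,1]$ on the vertex set $V$ of $K$ with $\sum_v x(v)=1$ and $\{v : x(v)>0\}\in K$, with the weak topology (a set is open if and only if its intersection with each closed simplex is open in that simplex). The Lusternik--Schnirelmann category $\mathrm{cat}(X)$ of a space $X$ is the least $n\ge 0$ such that $X$ is covered by $n+1$ open subsets, each of whose inclusions into $X$ is homotopic to a constant map. Two simplicial maps $\varphi,\psi\colon L\to K$ are contiguous if $\varphi(\sigma)\cup\psi(\sigma)$ is a simplex of $K$ for each simplex $\sigma$ of $L$, and they are in the same contiguity class if they are joined by a finite sequence of simplicial maps $L\to K$ in which consecutive maps are contiguous. A subcomplex $L\subseteq K$ is categorical if, for some vertex $v_0$ of $K$, the inclusion $L\hookrightarrow K$ and the constant map $L\to K$ at $v_0$ are in the same contiguity class. The simplicial LS category $\mathrm{scat}(K)$ is the least $n\ge 0$ such that $K$ is a union of $n+1$ categorical subcomplexes. Both numbers are $\infty$ if no such $n$ exists. Then $$\mathrm{cat}(|K|)\le \mathrm{scat}(K).$$ -/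

import Mathlib

open scoped Classical

noncomputable section

namespace PreAbstractSimplicialComplex

variable {V W : Type*}

/-- The vertices of a simplicial complex: the points spanning a `0`-simplex. (A complex `K` whose
simplices are finite subsets of `V` may have a vertex set smaller than `V`, as subcomplexes do.) -/
def Vertex (K : PreAbstractSimplicialComplex V) : Type _ :=
  {v : V // {v} ∈ K.faces}

/-- Simplicial maps: maps between the vertex sets that send simplices to simplices. -/
structure SimplicialMap (K : PreAbstractSimplicialComplex V)
    (K' : PreAbstractSimplicialComplex W) where
  /-- the map on vertices -/
  toFun : K.Vertex → K'.Vertex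
  /-- the image of a simplex is a simplex -/
  map_face : ∀ s : Finset K.Vertex, s.image (fun v => v.1) ∈ K.faces →
    s.image (fun v => (toFun v).1) ∈ K'.faces

/-- Two simplicial maps `φ, ψ` are contiguous if `φ(σ) ∪ ψ(σ)` is a simplex for every
simplex `σ`. -/
def Contiguous {K : PreAbstractSimplicialComplex V} {K' : PreAbstractSimplicialComplex W}
    (φ ψ : SimplicialMap K K') : Prop :=
  ∀ s : Finset K.Vertex, s.image (fun v => v.1) ∈ K.faces →
    s.image (fun v => (φ.toFun v).1) ∪ s.image (fun v => (ψ.toFun v).1) ∈ K'.faces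

/-- Two simplicial maps are in the same contiguity class if they are joined by a finite sequence
of simplicial maps in which consecutive ones are contiguous. -/
def SameContiguityClass {K : PreAbstractSimplicialComplex V} {K' : PreAbstractSimplicialComplex W}
    (φ ψ : SimplicialMap K K') : Prop :=
  Relation.ReflTransGen Contiguous φ ψ

/-- The inclusion of a subcomplex. -/
def inclusion {L K : PreAbstractSimplicialComplex V} (h : L ≤ K) : SimplicialMap L K where
  toFun v := ⟨v.1, h v.2⟩
  map_face _ hs := h hs

/-- The constant simplicial map at a vertex. -/
def constMap (L : PreAbstractSimplicialComplex V) {K : PreAbstractSimplicialComplex W}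
    (v₀ : K.Vertex) : SimplicialMap L K where
  toFun _ := v₀
  map_face s hs := by
    have hne : s.Nonempty := Finset.image_nonempty.mp (L.isRelLowerSet_faces hs).1
    rw [Finset.image_const hne]
    exact v₀.2

/-- `L` is a categorical subcomplex of `K`: it is a subcomplex whose inclusion into `K` is in the
same contiguity class as the constant map at some vertex of `K`. -/
def IsCategorical (K L : PreAbstractSimplicialComplex V) : Prop :=
  ∃ (h : L ≤ K) (v₀ : K.Vertex), SameContiguityClass (inclusion h) (constMap L v₀)

/-- `K` is covered by `n + 1` categorical subcomplexes. -/
def HasCategoricalCover (K : PreAbstractSimplicialComplex V) (n : ℕ) : Prop :=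
  ∃ L : Fin (n + 1) → PreAbstractSimplicialComplex V,
    (∀ i, IsCategorical K (L i)) ∧ ∀ s ∈ K.faces, ∃ i, s ∈ (L i).faces

/-- The simplicial LS category: the least `n` such that `K` is covered by `n + 1` categorical
subcomplexes (`⊤` if there is no such `n`). -/
def scat (K : PreAbstractSimplicialComplex V) : ℕ∞ :=
  ⨅ (n : ℕ) (_ : HasCategoricalCover K n), (n : ℕ∞)

/-- The points of the geometric realization, in barycentric coordinates: finitely supported
functions with nonnegative values and total mass `1` whose support is a simplex of `K`. -/
def Realization (K : PreAbstractSimplicialComplex V) : Type _ :=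
  {x : V →₀ ℝ // x.support ∈ K.faces ∧ (∀ v, 0 ≤ x v) ∧ x.sum (fun _ a => a) = 1}

/-- The inclusion into the realization of the closed geometric simplex spanned by a face `σ`
(barycentric coordinates are extended by `0`). -/
def faceInclusion (K : PreAbstractSimplicialComplex V) (σ : Finset V) (hσ : σ ∈ K.faces)
    (x : stdSimplex ℝ σ) : K.Realization := by
  refine ⟨Finsupp.onFinset σ (fun v => if h : v ∈ σ then x.1 ⟨v, h⟩ else 0) ?_, ?_, ?_, ?_⟩
  · intro v hv
    by_contra h
    simp [h] at hv
  · refine (K.isRelLowerSet_faces hσ).2 Finsupp.support_onFinset_subset ?_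
    rw [Finset.nonempty_iff_ne_empty]
    intro h0
    have h1 := x.2.2
    have h2 : ∀ i, x.1 i = 0 := by
      intro i
      have := DFunLike.congr_fun (Finsupp.support_eq_empty.mp h0) i.1
      simpa using this
    simp [h2] at h1
  · intro v
    by_cases h : v ∈ σ
    · simpa [h] using x.2.1 ⟨v, h⟩
    · simp [h]
  · rw [Finsupp.onFinset_sum _ (fun _ => rfl), ← Finset.sum_attach, ← x.2.2]
    simp

/-- The weak topology: the finest one for which the inclusion of every closed simplex is
continuous, i.e. a set is open if and only if its trace on every closed simplex is open. -/
instance (K : PreAbstractSimplicialComplex V) : TopologicalSpace K.Realization :=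
  ⨆ (σ : Finset V) (hσ : σ ∈ K.faces),
    TopologicalSpace.coinduced (K.faceInclusion σ hσ) inferInstance

end PreAbstractSimplicialComplex

/-- `X` is covered by `n + 1` open subsets whose inclusions into `X` are nullhomotopic. -/
def HasNullhomotopicOpenCover (X : Type*) [TopologicalSpace X] (n : ℕ) : Prop :=
  ∃ U : Fin (n + 1) → Set X, (∀ i, IsOpen (U i)) ∧ (⋃ i, U i) = Set.univ ∧
    ∀ i, (⟨Subtype.val, continuous_subtype_val⟩ : C(U i, X)).Nullhomotopic

/-- The Lusternik–Schnirelmann category: the least `n` such that `X` is covered by `n + 1` open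
subsets whose inclusions into `X` are nullhomotopic (`⊤` if there is no such `n`). -/
def lsCat (X : Type*) [TopologicalSpace X] : ℕ∞ :=
  ⨅ (n : ℕ) (_ : HasNullhomotopicOpenCover X n), (n : ℕ∞)

end

/-!
A categorical subcomplex `L` of `K` has an open neighbourhood `U` in `|K|` whose inclusion into
`|K|` is nullhomotopic, so a cover of `K` by `n + 1` categorical subcomplexes gives a cover of `|K|`
by `n + 1` such open sets.

The neighbourhood is the open star of `L` in the barycentric subdivision of `K`, described without
subdividing. For `x ∈ |K|` let `c(x)` be the maximum of `min_{v ∈ s} x(v)` over the nonempty sets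
`s` that are not faces of `L`, or `0` if there are none (`threshold`). This is a continuous function
of `x`, and `{v | x(v) > c(x)}` is either empty or a face of `L`. Let `U` be the set of points for
which it is nonempty (`subcomplexNhd`). Replacing `x` by `(x - c(x))⁺`, normalized to total mass
`1`, gives a retraction `r : U → |L|` (`nhdRetraction`), and the segment from `x` to `r(x)` stays in
the simplex carrying `x`. Hence the inclusion of `U` is homotopic to `|i| ∘ r`, where `i : L → K` is
the inclusion (`subtypeVal_homotopic_nhdRetraction`).

Contiguous simplicial maps have homotopic realizations, again along segments
(`Contiguous.homotopic`), so `|i|` is homotopic to a constant map when `L` is categorical, and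
therefore so is `|i| ∘ r`.

Since `|K|` carries the weak topology, the continuity of these maps rests on two facts. A map into
`|K|` involving only finitely many vertices is continuous when its coordinates are
(`continuous_of_support_subset`). A family of straight-line homotopies is continuous when it is so
on pieces of the domain that generate its topology (`homotopic_of_common_face`): both `|L|` and the
open set `U` are generated by their traces on closed simplices.
-/

noncomputable section

namespace PreAbstractSimplicialComplex

variable {V W : Type*} {K : PreAbstractSimplicialComplex V} {K' : PreAbstractSimplicialComplex W}

/-! ### Continuity for the weak topology -/

/-- The barycentric coordinates of a point of the realization. -/
def Realization.coords (x : K.Realization) : V →₀ ℝ := x.1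

theorem Realization.support_mem (x : K.Realization) : x.coords.support ∈ K.faces := x.2.1

theorem Realization.coords_nonneg (x : K.Realization) (v : V) : 0 ≤ x.coords v := x.2.2.1 v

theorem Realization.sum_coords (x : K.Realization) : x.coords.sum (fun _ a => a) = 1 := x.2.2.2

theorem Realization.ext {x y : K.Realization} (h : ∀ v, x.coords v = y.coords v) : x = y :=
  Subtype.ext (Finsupp.ext h)

theorem faceInclusion_apply (σ : Finset V) (hσ : σ ∈ K.faces) (x : stdSimplex ℝ σ) (v : V) :
    (K.faceInclusion σ hσ x).coords v = if h : v ∈ σ then x.1 ⟨v, h⟩ else 0 := rfl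

theorem support_faceInclusion_subset (σ : Finset V) (hσ : σ ∈ K.faces) (x : stdSimplex ℝ σ) :
    (K.faceInclusion σ hσ x).coords.support ⊆ σ :=
  fun v hv => by
    by_contra h
    exact Finsupp.mem_support_iff.mp hv ((faceInclusion_apply σ hσ x v).trans (dif_neg h))

theorem continuous_faceInclusion (σ : Finset V) (hσ : σ ∈ K.faces) :
    Continuous (K.faceInclusion σ hσ) :=
  continuous_iff_coinduced_le.mpr <| le_iSup₂_of_le σ hσ le_rfl

theorem isOpen_realization_iff {s : Set K.Realization} :
    IsOpen s ↔ ∀ (σ : Finset V) (hσ : σ ∈ K.faces), IsOpen (K.faceInclusion σ hσ ⁻¹' s) := by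
  simp only [isOpen_iSup_iff, isOpen_coinduced]

theorem continuous_realization_iff {Y : Type*} [TopologicalSpace Y] {f : K.Realization → Y} :
    Continuous f ↔
      ∀ (σ : Finset V) (hσ : σ ∈ K.faces), Continuous (f ∘ K.faceInclusion σ hσ) := by
  simp only [continuous_iSup_dom, continuous_coinduced_dom]

theorem continuous_coord (v : V) : Continuous fun x : K.Realization => x.coords v := by
  refine continuous_realization_iff.mpr fun σ hσ => ?_
  by_cases h : v ∈ σ
  · have : (fun x : K.Realization => x.coords v) ∘ K.faceInclusion σ hσ
        = fun x => x.1 ⟨v, h⟩ := by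
      funext x; simp [faceInclusion_apply, h]
    rw [this]
    exact (continuous_apply _).comp continuous_subtype_val
  · have : (fun x : K.Realization => x.coords v) ∘ K.faceInclusion σ hσ = fun _ => 0 := by
      funext x; simp [faceInclusion_apply, h]
    rw [this]
    exact continuous_const

theorem sum_eq_one_of_support_subset (x : K.Realization) {τ : Finset V} (h : x.coords.support ⊆ τ) :
    ∑ v ∈ τ, x.coords v = 1 :=
  (Finsupp.sum_of_support_subset _ h (fun _ a => a) fun _ _ => rfl).symm.trans x.sum_coords

/-- A map into a realization is continuous as soon as its barycentric coordinates are, provided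
that it only involves finitely many vertices. These need not span a simplex: the domain is a
finite union of closed sets on each of which the map goes into one simplex. -/
theorem continuous_of_support_subset {Z : Type*} [TopologicalSpace Z] {g : Z → K.Realization}
    (τ : Finset V) (hτ : ∀ z, (g z).coords.support ⊆ τ)
    (hc : ∀ v, Continuous fun z => (g z).coords v) : Continuous g := by
  let ι := {ρ : Finset V // ρ ∈ τ.powerset ∧ ρ ∈ K.faces}
  have : Finite ι := Set.Finite.to_subtype (τ.powerset.finite_toSet.subset fun ρ h => h.1)
  let A : ι → Set Z := fun ρ => {z | ∀ v, v ∉ ρ.1 → (g z).coords v = 0}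
  have hAsupp : ∀ ρ z, z ∈ A ρ → (g z).coords.support ⊆ ρ.1 := by
    intro ρ z hz v hv
    by_contra h
    exact Finsupp.mem_support_iff.mp hv (hz v h)
  refine (locallyFinite_of_finite A).continuous ?_ ?_ ?_
  · refine Set.eq_univ_of_forall fun z => Set.mem_iUnion.mpr
      ⟨⟨(g z).coords.support, Finset.mem_powerset.mpr (hτ z), (g z).support_mem⟩, fun v hv => ?_⟩
    simpa using hv
  · intro ρ
    simp only [A, Set.ofPred_forall]
    exact isClosed_iInter fun v => isClosed_iInter fun _ => isClosed_eq (hc v) continuous_const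
  · intro ρ
    rw [continuousOn_iff_continuous_domRestrict]
    let q : A ρ → stdSimplex ℝ ρ.1 := fun z =>
      ⟨fun v => (g z).coords v, fun v => (g z).coords_nonneg _, by
        rw [Finset.sum_coe_sort ρ.1 fun v => (g z).coords v]
        exact sum_eq_one_of_support_subset _ (hAsupp ρ z z.2)⟩
    have hq : Continuous q := by
      refine continuous_induced_rng.mpr (continuous_pi fun v => ?_)
      exact (hc v).comp continuous_subtype_val
    have : (A ρ).domRestrict g = K.faceInclusion ρ.1 ρ.2.2 ∘ q := by
      funext z
      refine Realization.ext fun v => ?_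
      by_cases h : v ∈ ρ.1
      · exact ((faceInclusion_apply ρ.1 ρ.2.2 (q z) v).trans (dif_pos h)).symm
      · exact (z.2 v h).trans ((faceInclusion_apply ρ.1 ρ.2.2 (q z) v).trans (dif_neg h)).symm
    rw [this]
    exact (continuous_faceInclusion _ _).comp hq

/-! ### Straight-line homotopies -/

/-- The point dividing the segment from `a` to `b` in the ratio `t : 1 - t`, when `a` and `b` lie
in a common simplex. -/
def segmentPoint (a b : K.Realization) (h : a.coords.support ∪ b.coords.support ∈ K.faces)
    (t : unitInterval) : K.Realization := by
  have hs : ((1 - t : ℝ) • a.coords + (t : ℝ) • b.coords).support ⊆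
      a.coords.support ∪ b.coords.support :=
    Finsupp.support_add.trans
      (Finset.union_subset_union Finsupp.support_smul Finsupp.support_smul)
  have h1 : ((1 - t : ℝ) • a.coords + (t : ℝ) • b.coords).sum (fun _ r => r) = 1 := by
    rw [Finsupp.sum_of_support_subset _ hs _ fun _ _ => rfl]
    simp only [Finsupp.add_apply, Finsupp.smul_apply, smul_eq_mul, Finset.sum_add_distrib,
      ← Finset.mul_sum]
    rw [sum_eq_one_of_support_subset a Finset.subset_union_left,
      sum_eq_one_of_support_subset b Finset.subset_union_right]
    ring
  refine ⟨(1 - t : ℝ) • a.coords + (t : ℝ) • b.coords, (K.isRelLowerSet_faces h).2 hs ?_,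
    fun v => ?_, h1⟩
  · rw [Finset.nonempty_iff_ne_empty]
    intro h0
    rw [Finsupp.support_eq_empty.mp h0] at h1
    simp at h1
  · exact add_nonneg (mul_nonneg (by linarith [t.2.2]) (a.coords_nonneg v))
      (mul_nonneg t.2.1 (b.coords_nonneg v))

theorem segmentPoint_apply (a b : K.Realization)
    (h : a.coords.support ∪ b.coords.support ∈ K.faces)
    (t : unitInterval) (v : V) :
    (segmentPoint a b h t).coords v = (1 - t) * a.coords v + t * b.coords v := rfl

theorem support_segmentPoint_subset (a b : K.Realization)
    (h : a.coords.support ∪ b.coords.support ∈ K.faces) (t : unitInterval) :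
    (segmentPoint a b h t).coords.support ⊆ a.coords.support ∪ b.coords.support :=
  Finsupp.support_add.trans
    (Finset.union_subset_union Finsupp.support_smul Finsupp.support_smul)

/-- Two maps into `|K|` that send each point into a common simplex are homotopic along straight
lines. For the weak topology this needs a finiteness condition: the topology of `X` is coherent
with pieces on each of which both maps involve only finitely many vertices. -/
theorem homotopic_of_common_face {X : Type*} [TopologicalSpace X] {ι : Type*} {Z : ι → Type*}
    [∀ i, TopologicalSpace (Z i)] {p : ∀ i, Z i → X} (hp : ∀ i, Continuous (p i))
    (hX : ∀ s : Set X, (∀ i, IsOpen (p i ⁻¹' s)) → IsOpen s) {f g : C(X, K.Realization)}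
    (hfg : ∀ x, (f x).coords.support ∪ (g x).coords.support ∈ K.faces)
    (τ : ι → Finset V)
    (hτ : ∀ i z, (f (p i z)).coords.support ∪ (g (p i z)).coords.support ⊆ τ i) :
    f.Homotopic g := by
  -- Continuity is checked for the adjoint map into the path space, where it can be tested on the
  -- pieces of `X` without knowing that the pieces of `X × I` generate its topology.
  have hpath : ∀ x, Continuous (segmentPoint (f x) (g x) (hfg x)) := fun x =>
    continuous_of_support_subset _ (support_segmentPoint_subset _ _ _) fun v => by
      simp only [segmentPoint_apply]; fun_prop
  let F : X → C(unitInterval, K.Realization) := fun x => ⟨_, hpath x⟩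
  have hF : Continuous F := by
    refine continuous_def.mpr fun s hs => hX _ fun i => ?_
    have hFi : Continuous (F ∘ p i) := by
      refine ContinuousMap.continuous_of_continuous_uncurry _ ?_
      change Continuous fun z : Z i × unitInterval =>
        segmentPoint (f (p i z.1)) (g (p i z.1)) (hfg _) z.2
      refine continuous_of_support_subset (τ i)
        (fun z => (support_segmentPoint_subset _ _ (hfg _) z.2).trans (hτ i z.1)) fun v => ?_
      have h1 : Continuous fun z : Z i × unitInterval => (f (p i z.1)).coords v :=
        (continuous_coord v).comp (f.continuous.comp ((hp i).comp continuous_fst))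
      have h2 : Continuous fun z : Z i × unitInterval => (g (p i z.1)).coords v :=
        (continuous_coord v).comp (g.continuous.comp ((hp i).comp continuous_fst))
      simp only [segmentPoint_apply]
      change Continuous fun z : Z i × unitInterval =>
        (1 - (z.2 : ℝ)) * (f (p i z.1)).coords v + (z.2 : ℝ) * (g (p i z.1)).coords v
      exact ((continuous_const.sub (continuous_subtype_val.comp continuous_snd)).mul h1).add
        ((continuous_subtype_val.comp continuous_snd).mul h2)
    exact hs.preimage hFi
  let H : C(unitInterval × X, K.Realization) :=
    (ContinuousMap.uncurry ⟨F, hF⟩).comp ContinuousMap.prodSwap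
  refine ⟨⟨H, fun x => Realization.ext fun v => ?_, fun x => Realization.ext fun v => ?_⟩⟩
  · change (1 - (0 : ℝ)) * (f x).coords v + (0 : ℝ) * (g x).coords v = (f x).coords v
    ring
  · change (1 - (1 : ℝ)) * (f x).coords v + (1 : ℝ) * (g x).coords v = (g x).coords v
    ring

/-! ### The realization of a simplicial map -/

/-- The underlying point of a vertex. -/
def Vertex.val (v : K.Vertex) : V := v.1

theorem Vertex.val_injective : Function.Injective (Vertex.val : K.Vertex → V) :=
  fun _ _ h => Subtype.ext h

/-- The barycentric coordinates of a point as a function on the vertices of `K`. -/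
def vertexCoords (x : K.Realization) : K.Vertex →₀ ℝ :=
  x.coords.comapDomain Vertex.val Vertex.val_injective.injOn

theorem vertexCoords_apply (x : K.Realization) (v : K.Vertex) :
    vertexCoords x v = x.coords v.val := rfl

/-- The vertices carrying a point of the realization. -/
def vertexSupport (x : K.Realization) : Finset K.Vertex :=
  (vertexCoords x).support

theorem mem_vertexSupport {x : K.Realization} {v : K.Vertex} :
    v ∈ vertexSupport x ↔ v.val ∈ x.coords.support := by
  rw [vertexSupport, Finsupp.mem_support_iff, Finsupp.mem_support_iff, vertexCoords_apply]

theorem singleton_mem_faces {x : K.Realization} {v : V} (hv : v ∈ x.coords.support) :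
    {v} ∈ K.faces :=
  (K.isRelLowerSet_faces x.support_mem).2 (Finset.singleton_subset_iff.mpr hv)
    (Finset.singleton_nonempty v)

theorem image_vertexSupport (x : K.Realization) :
    (vertexSupport x).image Vertex.val = x.coords.support := by
  ext v
  constructor
  · intro h
    obtain ⟨w, hw, rfl⟩ := Finset.mem_image.mp h
    exact mem_vertexSupport.mp hw
  · intro h
    exact Finset.mem_image.mpr ⟨⟨v, singleton_mem_faces h⟩, mem_vertexSupport.mpr h, rfl⟩

theorem image_vertexSupport_mem (x : K.Realization) :
    (vertexSupport x).image Vertex.val ∈ K.faces := by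
  rw [image_vertexSupport]
  exact x.support_mem

/-- The affine extension of a vertex map, as a map on barycentric coordinates. -/
def pushCoords (φ : SimplicialMap K K') (x : K.Realization) : W →₀ ℝ :=
  (vertexCoords x).mapDomain fun v => (φ.toFun v).val

theorem support_pushCoords_subset (φ : SimplicialMap K K') (x : K.Realization) :
    (pushCoords φ x).support ⊆ (vertexSupport x).image fun v => (φ.toFun v).val :=
  Finsupp.mapDomain_support

theorem sum_pushCoords (φ : SimplicialMap K K') (x : K.Realization) :
    (pushCoords φ x).sum (fun _ a => a) = 1 := by
  rw [pushCoords, Finsupp.sum_mapDomain_index (fun _ => rfl) (fun _ _ _ => rfl)]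
  change ∑ v ∈ vertexSupport x, x.coords v.val = 1
  rw [← Finset.sum_image (f := fun v => x.coords v) Vertex.val_injective.injOn]
  exact sum_eq_one_of_support_subset x (image_vertexSupport x).ge

theorem pushCoords_apply (φ : SimplicialMap K K') (x : K.Realization) (w : W) :
    pushCoords φ x w =
      ∑ v ∈ vertexSupport x, if (φ.toFun v).val = w then x.coords v.val else 0 := by
  rw [pushCoords, Finsupp.mapDomain, Finsupp.sum_apply, Finsupp.sum]
  refine Finset.sum_congr rfl fun v _ => ?_
  rw [Finsupp.single_apply]
  rfl

/-- The map `|K| → |K'|` induced by a simplicial map: its affine extension to the simplices. -/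
def realizationMap (φ : SimplicialMap K K') (x : K.Realization) : K'.Realization := by
  refine ⟨pushCoords φ x, (K'.isRelLowerSet_faces (φ.map_face _ (image_vertexSupport_mem x))).2
    (support_pushCoords_subset φ x) ?_, fun w => ?_, sum_pushCoords φ x⟩
  · rw [Finset.nonempty_iff_ne_empty]
    intro h0
    have h1 := sum_pushCoords φ x
    rw [Finsupp.support_eq_empty.mp h0] at h1
    simp at h1
  · rw [pushCoords_apply]
    refine Finset.sum_nonneg fun v _ => ?_
    split_ifs
    exacts [x.coords_nonneg _, le_rfl]

/-- The vertices of a face, as vertices of the complex. -/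
def faceVertices (σ : Finset V) (hσ : σ ∈ K.faces) : Finset K.Vertex :=
  σ.attach.image fun v => ⟨v.1, (K.isRelLowerSet_faces hσ).2
    (Finset.singleton_subset_iff.mpr v.2) (Finset.singleton_nonempty _)⟩

theorem mem_faceVertices {σ : Finset V} {hσ : σ ∈ K.faces} {v : K.Vertex} :
    v ∈ faceVertices σ hσ ↔ v.val ∈ σ := by
  refine ⟨fun h => ?_, fun h => Finset.mem_image.mpr ⟨⟨v.1, h⟩, Finset.mem_attach _ _, rfl⟩⟩
  obtain ⟨w, -, rfl⟩ := Finset.mem_image.mp h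
  exact w.2

theorem vertexSupport_subset_faceVertices {x : K.Realization} {σ : Finset V} (hσ : σ ∈ K.faces)
    (h : x.coords.support ⊆ σ) : vertexSupport x ⊆ faceVertices σ hσ :=
  fun _ hv => mem_faceVertices.mpr (h (mem_vertexSupport.mp hv))

theorem support_realizationMap_subset (φ : SimplicialMap K K') {x : K.Realization} {σ : Finset V}
    (hσ : σ ∈ K.faces) (h : x.coords.support ⊆ σ) :
    (realizationMap φ x).coords.support ⊆ (faceVertices σ hσ).image fun v => (φ.toFun v).val :=
  (support_pushCoords_subset φ x).trans
    (Finset.image_subset_image (vertexSupport_subset_faceVertices hσ h))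

theorem continuous_realizationMap (φ : SimplicialMap K K') : Continuous (realizationMap φ) := by
  refine continuous_realization_iff.mpr fun σ hσ => ?_
  refine continuous_of_support_subset _ (fun z => support_realizationMap_subset φ hσ
    (support_faceInclusion_subset σ hσ z)) fun w => ?_
  have : (fun z => ((realizationMap φ ∘ K.faceInclusion σ hσ) z).coords w) = fun z =>
      ∑ v ∈ faceVertices σ hσ,
        if (φ.toFun v).val = w then (K.faceInclusion σ hσ z).coords v.val else 0 := by
    funext z
    refine (pushCoords_apply φ _ w).trans (Finset.sum_subset (vertexSupport_subset_faceVertices hσ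
      (support_faceInclusion_subset σ hσ z)) fun v _ hv => ?_)
    have h0 : (K.faceInclusion σ hσ z).coords v.val = 0 := by
      by_contra h
      exact hv (mem_vertexSupport.mpr (Finsupp.mem_support_iff.mpr h))
    rw [h0, ite_self]
  rw [this]
  refine continuous_finsetSum _ fun v _ => ?_
  split_ifs
  exacts [(continuous_coord v.val).comp (continuous_faceInclusion σ hσ), continuous_const]

/-- `realizationMap φ` as a continuous map. -/
def realizationMapC (φ : SimplicialMap K K') : C(K.Realization, K'.Realization) :=
  ⟨realizationMap φ, continuous_realizationMap φ⟩

theorem realizationMap_inclusion {L : PreAbstractSimplicialComplex V} (h : L ≤ K)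
    (x : L.Realization) : (realizationMap (inclusion h) x).coords = x.coords := by
  ext w
  refine (pushCoords_apply _ _ _).trans ?_
  change (∑ v ∈ vertexSupport x, if v.val = w then x.coords v.val else 0) = x.coords w
  by_cases hw : w ∈ x.coords.support
  · let w' : L.Vertex := ⟨w, singleton_mem_faces hw⟩
    refine (Finset.sum_eq_single w' ?_ ?_).trans (if_pos rfl)
    · intro v _ hv
      exact if_neg fun h' => hv (Vertex.val_injective h')
    · intro hn
      exact absurd (mem_vertexSupport.mpr hw) hn
  · have h0 : x.coords w = 0 := by simpa using hw
    rw [h0]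
    refine Finset.sum_eq_zero fun v _ => ?_
    split_ifs with h'
    · rw [h', h0]
    · rfl

/-- The point of the realization given by a vertex. -/
def vertexPoint (v : K.Vertex) : K.Realization := by
  refine ⟨Finsupp.single v.val 1, ?_, fun w => ?_, by simp⟩
  · rw [Finsupp.support_single _ one_ne_zero]
    exact v.2
  · rw [Finsupp.single_apply]
    split_ifs <;> norm_num

theorem realizationMap_constMap (v₀ : K'.Vertex) (x : K.Realization) :
    realizationMap (constMap K v₀) x = vertexPoint v₀ := by
  have h : (realizationMap (constMap K v₀) x).coords.support ⊆ {v₀.val} :=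
    (support_pushCoords_subset _ _).trans fun w hw => by
      obtain ⟨_, -, rfl⟩ := Finset.mem_image.mp hw
      exact Finset.mem_singleton_self _
  have h1 := sum_eq_one_of_support_subset _ h
  rw [Finset.sum_singleton] at h1
  refine Subtype.ext ((Finsupp.support_subset_singleton.mp h).trans ?_)
  rw [h1]
  rfl

theorem Contiguous.homotopic {φ ψ : SimplicialMap K K'} (h : Contiguous φ ψ) :
    (realizationMapC φ).Homotopic (realizationMapC ψ) := by
  refine homotopic_of_common_face (ι := {σ // σ ∈ K.faces})
    (p := fun σ => K.faceInclusion σ.1 σ.2)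
    (fun σ => continuous_faceInclusion σ.1 σ.2)
    (fun s hs => isOpen_realization_iff.mpr fun σ hσ => hs ⟨σ, hσ⟩) (fun x => ?_)
    (fun σ => (faceVertices σ.1 σ.2).image (fun v => (φ.toFun v).val) ∪
      (faceVertices σ.1 σ.2).image fun v => (ψ.toFun v).val)
    fun σ z => Finset.union_subset_union
      (support_realizationMap_subset φ σ.2 (support_faceInclusion_subset σ.1 σ.2 z))
      (support_realizationMap_subset ψ σ.2 (support_faceInclusion_subset σ.1 σ.2 z))
  refine (K'.isRelLowerSet_faces (h _ (image_vertexSupport_mem x))).2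
    (Finset.union_subset_union (support_pushCoords_subset φ x) (support_pushCoords_subset ψ x)) ?_
  · exact (K'.isRelLowerSet_faces (realizationMap φ x).support_mem).1.mono Finset.subset_union_left

theorem SameContiguityClass.homotopic {φ ψ : SimplicialMap K K'} (h : SameContiguityClass φ ψ) :
    (realizationMapC φ).Homotopic (realizationMapC ψ) := by
  induction h with
  | refl => exact .refl _
  | tail _ h ih => exact ih.trans (Contiguous.homotopic h)

/-! ### A neighbourhood of a subcomplex and its retraction -/

/-- The smallest coordinate of `x` over a nonempty finite set `s` that is not a face of `L`; by
convention `0` for the other sets. -/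
def nonfaceMin (L : PreAbstractSimplicialComplex V) (s : Finset V) (x : K.Realization) : ℝ :=
  if h : s.Nonempty ∧ s ∉ L.faces then s.inf' h.1 fun v => x.coords v else 0

theorem continuous_nonfaceMin (L : PreAbstractSimplicialComplex V) (s : Finset V) :
    Continuous fun x : K.Realization => nonfaceMin L s x := by
  unfold nonfaceMin
  split_ifs with h
  · exact Continuous.finset_inf'_apply h.1 fun v _ => continuous_coord v
  · exact continuous_const

theorem nonfaceMin_nonneg (L : PreAbstractSimplicialComplex V) (s : Finset V)
    (x : K.Realization) : 0 ≤ nonfaceMin L s x := by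
  unfold nonfaceMin
  split_ifs with h
  · exact Finset.le_inf' _ _ fun v _ => x.coords_nonneg v
  · exact le_rfl

theorem nonfaceMin_eq_zero {L : PreAbstractSimplicialComplex V} {s : Finset V}
    {x : K.Realization} (hs : ¬ s ⊆ x.coords.support) : nonfaceMin L s x = 0 := by
  refine le_antisymm ?_ (nonfaceMin_nonneg L s x)
  unfold nonfaceMin
  split_ifs with h
  · obtain ⟨v, hv, hvx⟩ := Finset.not_subset.mp hs
    exact (Finset.inf'_le _ hv).trans (Finsupp.notMem_support_iff.mp hvx).le
  · exact le_rfl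

/-- The least height `c ≥ 0` above which the superlevel set `{v | c < x v}` is empty or a face of
`L`, computed as the maximum over the nonfaces of `L` of the smallest coordinate of `x`. -/
def threshold (L : PreAbstractSimplicialComplex V) (x : K.Realization) : ℝ :=
  x.coords.support.powerset.sup' ⟨∅, Finset.empty_mem_powerset _⟩ fun s => nonfaceMin L s x

theorem nonfaceMin_le_threshold (L : PreAbstractSimplicialComplex V) (s : Finset V)
    {x : K.Realization} (hs : s ⊆ x.coords.support) : nonfaceMin L s x ≤ threshold L x :=
  Finset.le_sup' (fun s => nonfaceMin L s x) (Finset.mem_powerset.mpr hs)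

theorem threshold_nonneg (L : PreAbstractSimplicialComplex V) (x : K.Realization) :
    0 ≤ threshold L x :=
  (nonfaceMin_nonneg L ∅ x).trans (nonfaceMin_le_threshold L ∅ (Finset.empty_subset _))

theorem threshold_eq_sup' (L : PreAbstractSimplicialComplex V) {x : K.Realization} {τ : Finset V}
    (hτ : x.coords.support ⊆ τ) : threshold L x =
      τ.powerset.sup' ⟨∅, Finset.empty_mem_powerset _⟩ fun s => nonfaceMin L s x := by
  refine le_antisymm (Finset.sup'_mono _ (Finset.powerset_mono.mpr hτ) _)
    (Finset.sup'_le _ _ fun s _ => ?_)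
  by_cases h : s ⊆ x.coords.support
  · exact nonfaceMin_le_threshold L s h
  · rw [nonfaceMin_eq_zero h]
    exact threshold_nonneg L x

theorem continuous_threshold (L : PreAbstractSimplicialComplex V) :
    Continuous fun x : K.Realization => threshold L x := by
  refine continuous_realization_iff.mpr fun σ hσ => ?_
  have : (fun x : K.Realization => threshold L x) ∘ K.faceInclusion σ hσ = fun z =>
      σ.powerset.sup' ⟨∅, Finset.empty_mem_powerset _⟩
        fun s => nonfaceMin L s (K.faceInclusion σ hσ z) :=
    funext fun z => threshold_eq_sup' L (support_faceInclusion_subset σ hσ z)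
  rw [this]
  exact Continuous.finset_sup'_apply _ fun s _ =>
    (continuous_nonfaceMin L s).comp (continuous_faceInclusion σ hσ)

theorem threshold_eq_zero {L : PreAbstractSimplicialComplex V} {x : K.Realization}
    (hx : x.coords.support ∈ L.faces) : threshold L x = 0 := by
  refine le_antisymm (Finset.sup'_le _ _ fun s hs => ?_) (threshold_nonneg L x)
  unfold nonfaceMin
  split_ifs with h
  · exact absurd ((L.isRelLowerSet_faces hx).2 (Finset.mem_powerset.mp hs) h.1) h.2
  · exact le_rfl

/-- The part of the coordinates of `x` above the threshold. -/
def excess (L : PreAbstractSimplicialComplex V) (x : K.Realization) : V →₀ ℝ :=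
  x.coords.mapRange (fun a => max (a - threshold L x) 0)
    (max_eq_right (by linarith [threshold_nonneg L x]))

theorem excess_apply (L : PreAbstractSimplicialComplex V) (x : K.Realization) (v : V) :
    excess L x v = max (x.coords v - threshold L x) 0 := rfl

theorem excess_nonneg (L : PreAbstractSimplicialComplex V) (x : K.Realization) (v : V) :
    0 ≤ excess L x v :=
  le_max_right _ _

theorem support_excess_subset (L : PreAbstractSimplicialComplex V) (x : K.Realization) :
    (excess L x).support ⊆ x.coords.support :=
  Finsupp.support_mapRange

theorem continuous_excess_apply (L : PreAbstractSimplicialComplex V) (v : V) :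
    Continuous fun x : K.Realization => excess L x v :=
  ((continuous_coord v).sub (continuous_threshold L)).max continuous_const

theorem support_excess_mem {L : PreAbstractSimplicialComplex V} {x : K.Realization}
    (hne : (excess L x).support.Nonempty) : (excess L x).support ∈ L.faces := by
  by_contra h
  -- A nonface on which all coordinates exceed the threshold contradicts its maximality.
  have hle := nonfaceMin_le_threshold L _ (support_excess_subset L x)
  rw [nonfaceMin, dif_pos ⟨hne, h⟩] at hle
  obtain ⟨v, hv, hvle⟩ := (Finset.inf'_le_iff hne).mp hle
  refine Finsupp.mem_support_iff.mp hv ?_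
  rw [excess_apply]
  exact max_eq_right (by linarith)

/-- The total mass of `x` above the threshold. -/
def excessMass (L : PreAbstractSimplicialComplex V) (x : K.Realization) : ℝ :=
  (excess L x).sum fun _ a => a

theorem excessMass_eq_sum (L : PreAbstractSimplicialComplex V) {x : K.Realization} {τ : Finset V}
    (hτ : x.coords.support ⊆ τ) : excessMass L x = ∑ v ∈ τ, excess L x v :=
  Finsupp.sum_of_support_subset _ ((support_excess_subset L x).trans hτ) (fun _ a => a)
    fun _ _ => rfl

theorem continuous_excessMass (L : PreAbstractSimplicialComplex V) :
    Continuous fun x : K.Realization => excessMass L x := by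
  refine continuous_realization_iff.mpr fun σ hσ => ?_
  have : (fun x : K.Realization => excessMass L x) ∘ K.faceInclusion σ hσ = fun z =>
      ∑ v ∈ σ, excess L (K.faceInclusion σ hσ z) v :=
    funext fun z => excessMass_eq_sum L (support_faceInclusion_subset σ hσ z)
  rw [this]
  exact continuous_finsetSum _ fun v _ =>
    (continuous_excess_apply L v).comp (continuous_faceInclusion σ hσ)

/-- The open neighbourhood of `|L|` in `|K|` formed by the points whose superlevel sets
`{v | t < x v}` are faces of `L` for `t` close to the maximal coordinate; it is the open star of
`L` in the barycentric subdivision of `K`. -/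
def subcomplexNhd (K L : PreAbstractSimplicialComplex V) : Set K.Realization :=
  {x | 0 < excessMass L x}

theorem isOpen_subcomplexNhd (L : PreAbstractSimplicialComplex V) :
    IsOpen (subcomplexNhd K L) :=
  isOpen_lt continuous_const (continuous_excessMass L)

theorem mem_subcomplexNhd {L : PreAbstractSimplicialComplex V} {x : K.Realization}
    (hx : x.coords.support ∈ L.faces) : x ∈ subcomplexNhd K L := by
  change 0 < excessMass L x
  rw [excessMass_eq_sum L subset_rfl, Finset.sum_congr rfl fun v _ => ?_,
    sum_eq_one_of_support_subset x subset_rfl]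
  · exact one_pos
  · rw [excess_apply, threshold_eq_zero hx, sub_zero, max_eq_left (x.coords_nonneg v)]

/-- The retraction of the neighbourhood of `|L|` onto `|L|`: cut the coordinates at the
threshold and normalize. -/
def nhdRetraction (L : PreAbstractSimplicialComplex V) (x : subcomplexNhd K L) :
    L.Realization := by
  have hx : 0 < excessMass L x.1 := x.2
  have hsupp : ((excessMass L x.1)⁻¹ • excess L x.1).support = (excess L x.1).support :=
    Finsupp.support_smul_eq (inv_ne_zero hx.ne')
  refine ⟨(excessMass L x.1)⁻¹ • excess L x.1, ?_, fun v => ?_, ?_⟩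
  · rw [hsupp]
    refine support_excess_mem (Finset.nonempty_iff_ne_empty.mpr fun h0 => hx.ne' ?_)
    rw [excessMass, Finsupp.support_eq_empty.mp h0, Finsupp.sum_zero_index]
  · exact mul_nonneg (inv_nonneg.mpr hx.le) (excess_nonneg L x.1 v)
  · rw [Finsupp.sum_smul_index (fun _ => rfl), ← Finsupp.mul_sum]
    exact inv_mul_cancel₀ hx.ne'

theorem nhdRetraction_apply (L : PreAbstractSimplicialComplex V) (x : subcomplexNhd K L) (v : V) :
    (nhdRetraction L x).coords v = (excessMass L x.1)⁻¹ * excess L x.1 v := rfl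

theorem support_nhdRetraction_subset (L : PreAbstractSimplicialComplex V)
    (x : subcomplexNhd K L) : (nhdRetraction L x).coords.support ⊆ x.1.coords.support :=
  Finsupp.support_smul.trans (support_excess_subset L x.1)

/-- An open subset of the realization carries the topology coherent with its traces on the closed
simplices. -/
theorem isOpen_of_isOpen_preimage_faceInclusion {U : Set K.Realization} (hU : IsOpen U)
    {s : Set U} (hs : ∀ σ : {σ // σ ∈ K.faces}, IsOpen
      ((fun z : K.faceInclusion σ.1 σ.2 ⁻¹' U => (⟨K.faceInclusion σ.1 σ.2 z.1, z.2⟩ : U)) ⁻¹' s)) :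
    IsOpen s := by
  refine hU.isOpenEmbedding_subtypeVal.isOpen_iff_image_isOpen.mpr
    (isOpen_realization_iff.mpr fun σ hσ => ?_)
  have hV : IsOpen (K.faceInclusion σ hσ ⁻¹' U) := hU.preimage (continuous_faceInclusion σ hσ)
  have := hV.isOpenEmbedding_subtypeVal.isOpen_iff_image_isOpen.mp (hs ⟨σ, hσ⟩)
  convert this using 1
  ext z
  constructor
  · rintro ⟨u, hu, huz⟩
    have hz : K.faceInclusion σ hσ z ∈ U := huz ▸ u.2
    refine ⟨⟨z, hz⟩, ?_, rfl⟩
    have : (⟨K.faceInclusion σ hσ z, hz⟩ : U) = u := Subtype.ext huz.symm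
    change (⟨K.faceInclusion σ hσ z, hz⟩ : U) ∈ s
    rwa [this]
  · rintro ⟨z, hz, rfl⟩
    exact ⟨_, hz, rfl⟩

theorem continuous_restrict_faceInclusion {U : Set K.Realization} (σ : Finset V)
    (hσ : σ ∈ K.faces) : Continuous fun z : K.faceInclusion σ hσ ⁻¹' U =>
      (⟨K.faceInclusion σ hσ z.1, z.2⟩ : U) :=
  ((continuous_faceInclusion σ hσ).comp continuous_subtype_val).subtype_mk _

theorem continuous_nhdRetraction (L : PreAbstractSimplicialComplex V) :
    Continuous (nhdRetraction L : subcomplexNhd K L → L.Realization) := by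
  have hcoord : ∀ v, Continuous fun x : subcomplexNhd K L => (nhdRetraction L x).coords v := by
    intro v
    simp only [nhdRetraction_apply]
    exact (((continuous_excessMass L).comp continuous_subtype_val).inv₀ fun x =>
      (show 0 < excessMass L x.1 from x.2).ne').mul
        ((continuous_excess_apply L v).comp continuous_subtype_val)
  refine continuous_def.mpr fun s hs =>
    isOpen_of_isOpen_preimage_faceInclusion (isOpen_subcomplexNhd L) fun σ => ?_
  -- The image of `U ∩ |σ|` lies in the finite complex `L ∩ σ`, which need not be a simplex.
  have hc := continuous_of_support_subset σ.1
    (g := fun z : K.faceInclusion σ.1 σ.2 ⁻¹' subcomplexNhd K L =>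
      nhdRetraction L ⟨K.faceInclusion σ.1 σ.2 z.1, z.2⟩)
    (fun z => (support_nhdRetraction_subset L _).trans (support_faceInclusion_subset σ.1 σ.2 z.1))
    fun v => (hcoord v).comp (continuous_restrict_faceInclusion σ.1 σ.2)
  exact hs.preimage hc

/-- `nhdRetraction` as a continuous map. -/
def nhdRetractionC (K L : PreAbstractSimplicialComplex V) : C(subcomplexNhd K L, L.Realization) :=
  ⟨nhdRetraction L, continuous_nhdRetraction L⟩

theorem subtypeVal_homotopic_nhdRetraction {L : PreAbstractSimplicialComplex V} (h : L ≤ K) :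
    (⟨Subtype.val, continuous_subtype_val⟩ : C(subcomplexNhd K L, K.Realization)).Homotopic
      ((realizationMapC (inclusion h)).comp (nhdRetractionC K L)) := by
  have hsub : ∀ x : subcomplexNhd K L, x.1.coords.support ∪
      (realizationMap (inclusion h) (nhdRetraction L x)).coords.support = x.1.coords.support := by
    intro x
    refine Finset.union_eq_left.mpr ?_
    rw [realizationMap_inclusion]
    exact support_nhdRetraction_subset L x
  refine homotopic_of_common_face (ι := {σ // σ ∈ K.faces})
    (Z := fun σ => K.faceInclusion σ.1 σ.2 ⁻¹' subcomplexNhd K L)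
    (p := fun σ z => ⟨K.faceInclusion σ.1 σ.2 z.1, z.2⟩)
    (fun σ => continuous_restrict_faceInclusion σ.1 σ.2)
    (fun s hs => isOpen_of_isOpen_preimage_faceInclusion (isOpen_subcomplexNhd L) hs)
    (fun x => ?_) (fun σ => σ.1) fun σ z => ?_
  · exact Set.mem_of_eq_of_mem (hsub x) x.1.support_mem
  · exact (hsub ⟨K.faceInclusion σ.1 σ.2 z.1, z.2⟩).le.trans
      (support_faceInclusion_subset σ.1 σ.2 z.1)

/-! ### Comparison of the categories -/

theorem IsCategorical.nullhomotopic {L : PreAbstractSimplicialComplex V}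
    (hL : IsCategorical K L) : (⟨Subtype.val, continuous_subtype_val⟩ :
      C(subcomplexNhd K L, K.Realization)).Nullhomotopic := by
  obtain ⟨h, v₀, hc⟩ := hL
  refine ⟨vertexPoint v₀, (subtypeVal_homotopic_nhdRetraction h).trans ?_⟩
  have h1 := hc.homotopic.comp (.refl (nhdRetractionC K L))
  have h2 : (realizationMapC (constMap L v₀)).comp (nhdRetractionC K L) =
      ContinuousMap.const _ (vertexPoint v₀) :=
    ContinuousMap.ext fun x => realizationMap_constMap v₀ (nhdRetraction L x)
  rwa [h2] at h1

theorem HasCategoricalCover.hasNullhomotopicOpenCover {n : ℕ} (h : HasCategoricalCover K n) :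
    HasNullhomotopicOpenCover K.Realization n := by
  obtain ⟨L, hL, hcover⟩ := h
  refine ⟨fun i => subcomplexNhd K (L i), fun i => isOpen_subcomplexNhd (L i),
    Set.eq_univ_of_forall fun x => ?_, fun i => (hL i).nullhomotopic⟩
  obtain ⟨i, hi⟩ := hcover _ x.support_mem
  exact Set.mem_iUnion.mpr ⟨i, mem_subcomplexNhd hi⟩

end PreAbstractSimplicialComplex

end

theorem mainTheorem3 {V : Type*} (K : PreAbstractSimplicialComplex V) :
    lsCat K.Realization ≤ K.scat :=
  le_iInf₂ fun n hn => iInf₂_le n hn.hasNullhomotopicOpenCover
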